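/- Let $n\ge 1$, let $\Omega\subset\mathbb R^n$ be a bounded domain with (locally) $C^2$ boundary, and let $p:\Omega\to\mathbb R$ be continuous (possibly unbounded) with $p_-:=\inf_\Omega p>n$. For measurable $u:\Omega\to\mathbb R$ put $\rho_p(u)=\int_\Omega \frac{|u(x)|^{p(x)}}{p(x)}\,dx\in[0,\infty]$, and, if $u$ has a (locally integrable) distributional gradient $\nabla u$ on $\Omega$, put $\rho_{1,p}(u)=\rho_p(u)+\rho_p(|\nabla u|)$. Functions that agree almost everywhere are identified. Let $L^p(\Omega)$ be the set of $u$ with $\rho_p(\lambda u)<\infty$ for some $\lambda>0$, and $W^{1,p}(\Omega)$ the set of $u$ having a distributional gradient with $\rho_{1,p}(\lambda u)<\infty$ for some $\lambda>0$. A set $A\subset W^{1,p}(\Omega)$ is called $\rho_{1,p}$-closed if $u_j\in A$, $u\in W^{1,p}(\Omega)$ and $\rho_{1,p}(u_j-u)\to0$ imply $u\in A$; these sets are the closed sets of a topology on $W^{1,p}(\Omega)$, the modular topology $\tau_{1,p}$. Let $V_0^{1,p}(\Omega)$ be the intersection of all $\rho_{1,p}$-closed subsets of $W^{1,p}(\Omega)$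 that contain $C_0^\infty(\Omega)$. Let $(v_j)_{j\in\mathbb N}\subset V_0^{1,p}(\Omega)$ be such that $(\nabla v_j)$ is $\rho_p$-Cauchy, that is, $\rho_p(|\nabla v_j-\nabla v_k|)\to 0$ as $j,k\to\infty$. Then there is $v\in V_0^{1,p}(\Omega)$ such that $(v_j)$ $\rho_p$-converges to $v$ in $L^p(\Omega)$, i.e. $\rho_p(v_j-v)\to0$, and such that $(v_j)$ converges to $v$ modularly in $W^{1,p}(\Omega)$, i.e. $\rho_{1,p}(v_j-v)\to0$, and hence in the modular topology $\tau_{1,p}$. -/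

import Mathlib

open MeasureTheory Filter Topology Set
open scoped ENNReal ContDiff InnerProductSpace

noncomputable section

/-! ### Modular spaces and the modular topology -/

section Modular

variable {X : Type*} [AddCommGroup X] [Module ℝ X]

/-- The modular space `X_ρ` of a functional `ρ : X → [0, ∞]`. -/
def modularSpace (ρ : X → ℝ≥0∞) : Set X :=
  {x | ∃ c : ℝ, 0 < c ∧ ρ (c • x) < ⊤}

/-- Modular convergence `ρ (x_j - y) → 0` of a sequence. -/
def ModularTendsto (ρ : X → ℝ≥0∞) (x : ℕ → X) (y : X) : Prop :=
  Tendsto (fun j => ρ (x j - y)) atTop (𝓝 0)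

/-- A subset `A` of `X_ρ` is `ρ`-closed when it contains the modular limits in `X_ρ` of all
its sequences. -/
def IsModularClosed (ρ : X → ℝ≥0∞) (A : Set (modularSpace ρ)) : Prop :=
  ∀ (x : ℕ → modularSpace ρ) (y : modularSpace ρ),
    (∀ j, x j ∈ A) → ModularTendsto ρ (fun j => (x j : X)) y → y ∈ A

/-- The `ρ`-closure: the intersection of all `ρ`-closed subsets of `X_ρ` containing `A`. -/
def modularClosure (ρ : X → ℝ≥0∞) (A : Set (modularSpace ρ)) : Set (modularSpace ρ) :=
  ⋂₀ {F | IsModularClosed ρ F ∧ A ⊆ F}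

theorem IsModularClosed.union {ρ : X → ℝ≥0∞} {A B : Set (modularSpace ρ)}
    (hA : IsModularClosed ρ A) (hB : IsModularClosed ρ B) : IsModularClosed ρ (A ∪ B) := by
  intro x y hx hxy
  by_cases h : ∃ᶠ j in atTop, x j ∈ A
  · obtain ⟨s, hs, hsA⟩ := extraction_of_frequently_atTop h
    exact Or.inl (hA (x ∘ s) y hsA (hxy.comp hs.tendsto_atTop))
  · have h' : ∀ᶠ j in atTop, x j ∉ A := not_frequently.mp h
    obtain ⟨s, hs, hsA⟩ := extraction_of_frequently_atTop h'.frequently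
    exact Or.inr (hB (x ∘ s) y (fun j => (hx (s j)).resolve_left (hsA j))
      (hxy.comp hs.tendsto_atTop))

/-- The modular topology on `X_ρ`, whose closed sets are the `ρ`-closed sets. -/
abbrev modularTopology (ρ : X → ℝ≥0∞) : TopologicalSpace (modularSpace ρ) :=
  TopologicalSpace.ofClosed {A | IsModularClosed ρ A}
    (fun _ _ hx _ => (hx 0).elim)
    (fun _ hS x y hx hxy A hA => hS hA x y (fun j => hx j A hA) hxy)
    (fun _ hA _ hB => hA.union hB)

end Modular

/-! ### Bounded domains of class `C²` -/

/-- `Ω` is a domain (open, connected, nonempty), bounded, and its boundary is locally `C²`: near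
every boundary point, `Ω` is the set of points lying strictly above the graph of a `C²` function
of the component orthogonal to some unit vector `e`, the height being measured along `e`. (The
function is only evaluated on the hyperplane orthogonal to `e`; a `C²` function on this hyperplane
is the same as the restriction of a `C²` function on the whole space.) -/
structure IsBoundedC2Domain {n : ℕ} (Ω : Set (EuclideanSpace ℝ (Fin n))) : Prop where
  isOpen : IsOpen Ω
  isConnected : IsConnected Ω
  isBounded : Bornology.IsBounded Ω
  boundary : ∀ P ∈ frontier Ω, ∃ (e : EuclideanSpace ℝ (Fin n))
    (ψ : EuclideanSpace ℝ (Fin n) → ℝ) (r : ℝ), ‖e‖ = 1 ∧ ContDiff ℝ 2 ψ ∧ 0 < r ∧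
      ∀ x ∈ Metric.ball P r, x ∈ Ω ↔ ψ (x - ⟪e, x⟫_ℝ • e) < ⟪e, x⟫_ℝ

/-! ### Variable exponent Lebesgue and Sobolev spaces -/

section Sobolev

variable {n : ℕ}

/-- The infimum `p₋` of `p` over `Ω`. (If `p` is unbounded below on `Ω`, or `Ω` is empty, this
real number is `0`, hence `n < p₋` fails in these cases.) -/
def exponentInf (Ω : Set (EuclideanSpace ℝ (Fin n))) (p : EuclideanSpace ℝ (Fin n) → ℝ) : ℝ :=
  sInf (p '' Ω)

/-- The modular `ρ_p(u) = ∫_Ω |u(x)| ^ p(x) / p(x) dx`, with values in `[0, ∞]`. -/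
def lpModular (Ω : Set (EuclideanSpace ℝ (Fin n))) (p : EuclideanSpace ℝ (Fin n) → ℝ)
    (u : EuclideanSpace ℝ (Fin n) → ℝ) : ℝ≥0∞ :=
  ∫⁻ x in Ω, ENNReal.ofReal (|u x| ^ p x / p x)

/-- The space of test functions `C₀^∞(Ω)`. -/
def IsTestFunction (Ω : Set (EuclideanSpace ℝ (Fin n)))
    (φ : EuclideanSpace ℝ (Fin n) → ℝ) : Prop :=
  ContDiff ℝ ∞ φ ∧ HasCompactSupport φ ∧ tsupport φ ⊆ Ω

/-- The locally integrable vector field `g` is the distributional gradient on `Ω` of the locally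
integrable function `u`. -/
def HasWeakGradient (Ω : Set (EuclideanSpace ℝ (Fin n))) (u : EuclideanSpace ℝ (Fin n) → ℝ)
    (g : EuclideanSpace ℝ (Fin n) → EuclideanSpace ℝ (Fin n)) : Prop :=
  LocallyIntegrableOn u Ω ∧ LocallyIntegrableOn g Ω ∧
    ∀ φ, IsTestFunction Ω φ → ∀ i : Fin n,
      ∫ x in Ω, u x * fderiv ℝ φ x (EuclideanSpace.single i 1) = - ∫ x in Ω, g x i * φ x

open Classical in
/-- The distributional gradient `∇u` on `Ω` (unique up to null sets when it exists), and `0` if `u`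
does not have one. -/
def weakGradient (Ω : Set (EuclideanSpace ℝ (Fin n))) (u : EuclideanSpace ℝ (Fin n) → ℝ) :
    EuclideanSpace ℝ (Fin n) → EuclideanSpace ℝ (Fin n) :=
  if h : ∃ g, HasWeakGradient Ω u g then h.choose else 0

/-- Real-valued measurable functions on `Ω`, up to equality almost everywhere. -/
abbrev MeasurableClass (Ω : Set (EuclideanSpace ℝ (Fin n))) : Type :=
  EuclideanSpace ℝ (Fin n) →ₘ[volume.restrict Ω] ℝ

open Classical in
/-- The modular `ρ_{1,p}(u) = ρ_p(u) + ρ_p(|∇u|)`; it is `∞` on functions without a distributional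
gradient, which thereby stay outside the modular space. -/
def sobolevModular (Ω : Set (EuclideanSpace ℝ (Fin n))) (p : EuclideanSpace ℝ (Fin n) → ℝ)
    (u : MeasurableClass Ω) : ℝ≥0∞ :=
  if ∃ g, HasWeakGradient Ω u g then
    lpModular Ω p u + lpModular Ω p (fun x => ‖weakGradient Ω u x‖)
  else ⊤

/-- The variable exponent Lebesgue space `L^p(Ω)`. -/
def lebesgueSpace (Ω : Set (EuclideanSpace ℝ (Fin n))) (p : EuclideanSpace ℝ (Fin n) → ℝ) :
    Set (MeasurableClass Ω) :=
  modularSpace (fun u : MeasurableClass Ω => lpModular Ω p u)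

/-- The variable exponent Sobolev space `W^{1,p}(Ω)`. -/
abbrev sobolevSpace (Ω : Set (EuclideanSpace ℝ (Fin n))) (p : EuclideanSpace ℝ (Fin n) → ℝ) :
    Set (MeasurableClass Ω) :=
  modularSpace (sobolevModular Ω p)

theorem sobolevSpace_subset_lebesgueSpace (Ω : Set (EuclideanSpace ℝ (Fin n)))
    (p : EuclideanSpace ℝ (Fin n) → ℝ) : sobolevSpace Ω p ⊆ lebesgueSpace Ω p := by
  rintro u ⟨c, hc, hu⟩
  refine ⟨c, hc, lt_of_le_of_lt ?_ hu⟩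
  unfold sobolevModular
  split_ifs
  · exact le_self_add
  · exact le_top

/-- `V₀^{1,p}(Ω)`: the `ρ_{1,p}`-closure of `C₀^∞(Ω)` in `W^{1,p}(Ω)`. -/
def V0Space (Ω : Set (EuclideanSpace ℝ (Fin n))) (p : EuclideanSpace ℝ (Fin n) → ℝ) :
    Set (sobolevSpace Ω p) :=
  modularClosure (sobolevModular Ω p)
    {u | ∃ φ, IsTestFunction Ω φ ∧ (u : MeasurableClass Ω) =ᵐ[volume.restrict Ω] φ}

end Sobolev

end

/-! ### Sup bound by the `L^q` norm of the gradient, `q > n` -/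

section SupBound

/-! Put `q = p₋ > n`. As `p` may be unbounded, the modular has no doubling property, so modular
convergence cannot be handled like norm convergence. The way around is to pass through the normed
space `L^q(Ω)`.

A small modular forces a small `L^q` norm (`exists_eLpNorm_le_of_lpModular_le`): `p` is bounded off
a set of small measure, and large values of `t` satisfy `t^q ≤ q * (t^p / p)` uniformly in `p ≥ q`.
Hence the pairs `(u, ∇u)` that are `L^q` limits of test functions and their gradients form a
`ρ_{1,p}`-closed condition, and every element of `V₀` satisfies it (`isTestLimit_of_mem_V0Space`).
This condition is stable under differences, and the Morrey type bound `‖φ‖_∞ ≤ C ‖∇φ‖_q` extends to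
it.

So `(∇v_j)` is Cauchy in `L^q` and `(v_j)` is Cauchy in `L^∞`. Uniform convergence gives `ρ_p(v_j -
v) → 0`, since `t^p / p ≤ t` for `0 ≤ t ≤ 1` and `Ω` has finite measure. For the gradients, Fatou's
lemma along an a.e. convergent subsequence turns the modular Cauchy condition into modular
convergence to the `L^q` limit, which is the weak gradient of `v`. Finally `V₀` is itself
`ρ_{1,p}`-closed, so it contains `v`. -/

theorem enorm_le_lintegral_ray {E : Type*} [NormedAddCommGroup E] [NormedSpace ℝ E]
    {φ : E → ℝ} (hφ : ContDiff ℝ 1 φ) (hc : HasCompactSupport φ)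
    (x : E) {θ : E} (hθ : ‖θ‖ = 1) :
    ‖φ x‖ₑ ≤ ∫⁻ r in Ioi (0 : ℝ), ‖fderiv ℝ φ (x + r • θ)‖ₑ := by
  -- The ray is run backwards so that `x` is the right endpoint of `(-∞, 0]`, the half-line in the
  -- one-dimensional estimate.
  have hA : ContDiff ℝ 1 fun r : ℝ => x + (-r) • θ := by fun_prop
  have hcl : Topology.IsClosedEmbedding fun r : ℝ => x + (-r) • θ := by
    refine Isometry.isClosedEmbedding (Isometry.of_dist_eq fun a b => ?_)
    rw [dist_add_left, dist_eq_norm, ← sub_smul, norm_smul, hθ, mul_one, Real.dist_eq,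
      Real.norm_eq_abs, neg_sub_neg, abs_sub_comm]
  have h1 := (hc.comp_isClosedEmbedding hcl).enorm_le_lintegral_Ici_deriv (hφ.comp hA) 0
  have h2 : ∀ r : ℝ, ‖deriv (φ ∘ fun r : ℝ => x + (-r) • θ) r‖ₑ
      ≤ ‖fderiv ℝ φ (x + (-r) • θ)‖ₑ := by
    intro r
    have hd : HasDerivAt (fun r : ℝ => x + (-r) • θ) (-θ) r := by
      simpa using (((hasDerivAt_id r).neg).smul_const θ).const_add x
    have := ((hφ.differentiable one_ne_zero) (x + (-r) • θ)).hasFDerivAt.comp_hasDerivAt r hd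
    rw [this.deriv, ← ofReal_norm, ← ofReal_norm]
    refine ENNReal.ofReal_le_ofReal ?_
    simpa [hθ] using (fderiv ℝ φ (x + (-r) • θ)).le_opNorm (-θ)
  calc ‖φ x‖ₑ ≤ _ := by simpa using h1
    _ ≤ ∫⁻ r in Iic (0 : ℝ), ‖fderiv ℝ φ (x + (-r) • θ)‖ₑ := lintegral_mono h2
    _ = ∫⁻ r in Ioi (0 : ℝ), ‖fderiv ℝ φ (x + r • θ)‖ₑ := by
      rw [Measure.restrict_congr_set Iio_ae_eq_Iic.symm]
      have := (Measure.measurePreserving_neg (volume : Measure ℝ)).setLIntegral_comp_preimage_emb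
        (MeasurableEquiv.neg ℝ).measurableEmbedding (fun r => ‖fderiv ℝ φ (x + r • θ)‖ₑ) (Ioi 0)
      simpa using this

variable {E : Type*} [NormedAddCommGroup E] [NormedSpace ℝ E] [MeasurableSpace E] [BorelSpace E]
  [FiniteDimensional ℝ E]

theorem lintegral_eq_lintegral_toSphere_lintegral_Ioi (μ : Measure E) [μ.IsAddHaarMeasure]
    [Nontrivial E] {h : E → ℝ≥0∞} (hh : Measurable h) :
    ∫⁻ y, h y ∂μ = ∫⁻ θ, (∫⁻ r in Ioi (0 : ℝ),
      ENNReal.ofReal (r ^ (Module.finrank ℝ E - 1)) * h (r • (θ : E))) ∂μ.toSphere := by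
  have h1 : ∫⁻ y, h y ∂μ = ∫⁻ y : ({(0)}ᶜ : Set E), h y.1 ∂(μ.comap (↑)) := by
    rw [lintegral_subtype_comap (measurableSet_singleton _).compl, restrict_compl_singleton]
  have h2 : Measurable fun z : Metric.sphere (0 : E) 1 × Ioi (0 : ℝ) => h (z.2.1 • z.1.1) := by
    fun_prop
  have h3 := (μ.measurePreserving_homeomorphUnitSphereProd).lintegral_comp h2
  have h4 : ∀ y : ({(0)}ᶜ : Set E),
      (homeomorphUnitSphereProd E y).2.1 • (homeomorphUnitSphereProd E y).1.1 = y.1 := by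
    intro y
    have : y.1 ≠ 0 := y.2
    simp [smul_smul, mul_inv_cancel₀ (norm_ne_zero_iff.2 this)]
  simp only [h4] at h3
  rw [h1, h3, lintegral_prod _ h2.aemeasurable]
  refine lintegral_congr fun θ => ?_
  have h5 : Measurable fun r : Ioi (0 : ℝ) => h (r.1 • (θ : E)) := by fun_prop
  rw [Measure.volumeIoiPow, lintegral_withDensity_eq_lintegral_mul _ (by fun_prop) h5,
    ← lintegral_subtype_comap measurableSet_Ioi]
  rfl

/-- Average the ray estimate over all directions: in polar coordinates the Jacobian `r^(d-1)`
cancels the kernel `‖y‖^(-(d-1))`. -/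
theorem toSphere_univ_mul_enorm_le_lintegral (μ : Measure E) [μ.IsAddHaarMeasure]
    [Nontrivial E] {φ : E → ℝ} (hφ : ContDiff ℝ 1 φ) (hc : HasCompactSupport φ) (x : E) :
    μ.toSphere univ * ‖φ x‖ₑ ≤
      ∫⁻ y, ENNReal.ofReal ((‖y‖ ^ (Module.finrank ℝ E - 1))⁻¹) * ‖fderiv ℝ φ (x + y)‖ₑ ∂μ := by
  have hm : Measurable fun y => ‖fderiv ℝ φ (x + y)‖ₑ :=
    ((hφ.continuous_fderiv one_ne_zero).comp (continuous_const.add continuous_id)).enorm.measurable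
  rw [lintegral_eq_lintegral_toSphere_lintegral_Ioi μ (by fun_prop), mul_comm, ← lintegral_const]
  refine lintegral_mono fun θ => ?_
  have hθ : ‖(θ : E)‖ = 1 := by simp
  refine (enorm_le_lintegral_ray hφ hc x hθ).trans (le_of_eq ?_)
  refine setLIntegral_congr_fun measurableSet_Ioi fun r hr => ?_
  have hr : 0 < r := hr
  rw [norm_smul, hθ, mul_one, Real.norm_of_nonneg hr.le, ← mul_assoc,
    ← ENNReal.ofReal_mul (by positivity), mul_inv_cancel₀ (by positivity), ENNReal.ofReal_one,
    one_mul]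

theorem lintegral_ball_norm_pow_inv_rpow_lt_top (μ : Measure E) [μ.IsAddHaarMeasure]
    [Nontrivial E] {s : ℝ} (hs0 : 0 < s)
    (hs : ((Module.finrank ℝ E : ℝ) - 1) * s < Module.finrank ℝ E) (R : ℝ) :
    ∫⁻ y in Metric.ball (0 : E) R,
      ENNReal.ofReal ((‖y‖ ^ (Module.finrank ℝ E - 1))⁻¹) ^ s ∂μ < ⊤ := by
  set d := Module.finrank ℝ E with hd
  have hd0 : 0 < d := Module.finrank_pos
  have hI : IntegrableOn (fun x : E => ((‖x‖ ^ (d - 1))⁻¹) ^ s) (Metric.ball 0 R) μ := by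
    rw [integrableOn_fun_norm_addHaar μ (f := fun t => ((t ^ (d - 1))⁻¹) ^ s)]
    rcases le_or_gt R 0 with hR | hR
    · simp [Ioo_eq_empty (not_lt.2 hR)]
    -- The Jacobian contributes `t^(d-1)`, so the radial exponent is `(d-1)(1-s)`; it exceeds `-1`
    -- exactly when `(d-1)s < d`.
    have h1 : IntegrableOn (fun t : ℝ => t ^ (((d : ℝ) - 1) * (1 - s))) (Ioo 0 R) := by
      refine (intervalIntegral.integrableOn_Ioo_rpow_iff hR).2 ?_
      nlinarith
    refine h1.congr_fun (fun t ht => ?_) measurableSet_Ioo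
    have ht0 : 0 < t := ht.1
    have hc : ((d - 1 : ℕ) : ℝ) = (d : ℝ) - 1 := by
      rw [Nat.cast_sub hd0]; simp
    simp only [smul_eq_mul]
    rw [← Real.rpow_natCast, hc, ← Real.rpow_neg ht0.le, ← Real.rpow_mul ht0.le,
      ← Real.rpow_add ht0]
    congr 1
    ring
  refine lt_of_le_of_lt (le_of_eq ?_) hI.lintegral_lt_top
  refine lintegral_congr fun y => ?_
  rw [ENNReal.ofReal_rpow_of_nonneg (by positivity) hs0.le]

/-- A Morrey type inequality: if `q > dim E`, then the supremum of a compactly supported `C¹`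
function vanishing outside a bounded set is controlled by the `L^q` norm of its derivative. -/
theorem exists_enorm_le_mul_eLpNorm_fderiv (μ : Measure E) [μ.IsAddHaarMeasure] [Nontrivial E]
    {q : ℝ} (hq : (Module.finrank ℝ E : ℝ) < q) {S : Set E} (hS : Bornology.IsBounded S) :
    ∃ C : ℝ≥0∞, C ≠ ⊤ ∧ ∀ φ : E → ℝ, ContDiff ℝ 1 φ → HasCompactSupport φ → tsupport φ ⊆ S →
      ∀ x, ‖φ x‖ₑ ≤ C * eLpNorm (fderiv ℝ φ) (ENNReal.ofReal q) (μ.restrict S) := by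
  set d := Module.finrank ℝ E with hd
  have hd1 : (1 : ℝ) ≤ d := by exact_mod_cast (Module.finrank_pos : 0 < Module.finrank ℝ E)
  have hq1 : 1 < q := hd1.trans_lt hq
  obtain ⟨R, hR⟩ := hS.subset_ball (0 : E)
  have hpq : (q.conjExponent).HolderConjugate q := (Real.HolderConjugate.conjExponent hq1).symm
  have hs0 : 0 < q.conjExponent := hpq.pos
  -- For the conjugate exponent `q/(q-1)` this integrability condition is equivalent to `q > d`.
  have hs : ((d : ℝ) - 1) * q.conjExponent < d := by
    rw [Real.conjExponent, mul_div_assoc', div_lt_iff₀ (by linarith)]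
    nlinarith
  set K := (∫⁻ y in Metric.ball (0 : E) (R + R),
      ENNReal.ofReal ((‖y‖ ^ (d - 1))⁻¹) ^ q.conjExponent ∂μ) ^ (1 / q.conjExponent) with hK
  have hKt : K ≠ ⊤ := ENNReal.rpow_ne_top_of_nonneg (by positivity)
    (lintegral_ball_norm_pow_inv_rpow_lt_top μ hs0 hs _).ne
  have hσ0 : μ.toSphere univ ≠ 0 := by
    rw [Ne, Measure.measure_univ_eq_zero]
    exact μ.toSphere_ne_zero
  have hσt : μ.toSphere univ ≠ ⊤ := measure_ne_top _ _
  refine ⟨(μ.toSphere univ)⁻¹ * K, ENNReal.mul_ne_top (ENNReal.inv_ne_top.2 hσ0) hKt, ?_⟩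
  intro φ hφ hc hsupp x
  by_cases hx : x ∈ S
  swap
  · rw [image_eq_zero_of_notMem_tsupport fun h => hx (hsupp h)]
    simp
  have hm : Measurable (fun y => ‖fderiv ℝ φ y‖ₑ) :=
    (hφ.continuous_fderiv one_ne_zero).enorm.measurable
  have hzero : ∀ y ∉ S, ‖fderiv ℝ φ y‖ₑ = 0 := fun y hy => by
    rw [← ofReal_norm, image_eq_zero_of_notMem_tsupport
      fun h => hy (hsupp (tsupport_fderiv_subset ℝ h)), norm_zero, ENNReal.ofReal_zero]
  have h1 := toSphere_univ_mul_enorm_le_lintegral μ hφ hc x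
  -- Only `y` with both `x` and `x + y` in `S ⊆ ball 0 R` contribute, so the kernel is needed only
  -- on a ball of radius `2R`, whatever `x` is.
  have h2 : ∫⁻ y, ENNReal.ofReal ((‖y‖ ^ (d - 1))⁻¹) * ‖fderiv ℝ φ (x + y)‖ₑ ∂μ
      = ∫⁻ y in Metric.ball (0 : E) (R + R),
        ENNReal.ofReal ((‖y‖ ^ (d - 1))⁻¹) * ‖fderiv ℝ φ (x + y)‖ₑ ∂μ := by
    symm
    refine setLIntegral_eq_of_support_subset fun y hy => ?_
    have hxy : x + y ∈ S := by
      by_contra h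
      simp [hzero _ h] at hy
    have a := mem_ball_zero_iff.1 (hR hxy)
    have b := mem_ball_zero_iff.1 (hR hx)
    rw [mem_ball_zero_iff]
    calc ‖y‖ = ‖(x + y) - x‖ := by simp
      _ ≤ ‖x + y‖ + ‖x‖ := norm_sub_le _ _
      _ < R + R := add_lt_add a b
  have h3 := ENNReal.lintegral_mul_le_Lp_mul_Lq (μ.restrict (Metric.ball (0 : E) (R + R))) hpq
    (f := fun y => ENNReal.ofReal ((‖y‖ ^ (d - 1))⁻¹)) (g := fun y => ‖fderiv ℝ φ (x + y)‖ₑ)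
    (by fun_prop) (by fun_prop)
  have h4 : (∫⁻ y in Metric.ball (0 : E) (R + R), ‖fderiv ℝ φ (x + y)‖ₑ ^ q ∂μ) ^ (1 / q)
      ≤ eLpNorm (fderiv ℝ φ) (ENNReal.ofReal q) (μ.restrict S) := by
    rw [eLpNorm_eq_lintegral_rpow_enorm_toReal (by simpa using by linarith) ENNReal.ofReal_ne_top,
      ENNReal.toReal_ofReal (by linarith)]
    refine ENNReal.rpow_le_rpow ?_ (by positivity)
    calc _ ≤ ∫⁻ y, ‖fderiv ℝ φ (x + y)‖ₑ ^ q ∂μ := setLIntegral_le_lintegral _ _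
      _ = ∫⁻ y, ‖fderiv ℝ φ y‖ₑ ^ q ∂μ :=
        lintegral_add_left_eq_self (fun y => ‖fderiv ℝ φ y‖ₑ ^ q) x
      _ = ∫⁻ y in S, ‖fderiv ℝ φ y‖ₑ ^ q ∂μ := by
        symm
        refine setLIntegral_eq_of_support_subset fun y hy => ?_
        by_contra h
        simp [hzero _ h, show 0 < q by linarith] at hy
  have h5 : μ.toSphere univ * ‖φ x‖ₑ
      ≤ K * eLpNorm (fderiv ℝ φ) (ENNReal.ofReal q) (μ.restrict S) :=
    h1.trans (h2.le.trans (h3.trans (by rw [hK]; gcongr)))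
  calc ‖φ x‖ₑ = (μ.toSphere univ)⁻¹ * (μ.toSphere univ * ‖φ x‖ₑ) := by
        rw [← mul_assoc, ENNReal.inv_mul_cancel hσ0 hσt, one_mul]
    _ ≤ (μ.toSphere univ)⁻¹ * (K * eLpNorm (fderiv ℝ φ) (ENNReal.ofReal q) (μ.restrict S)) := by
        gcongr
    _ = _ := by rw [mul_assoc]

end SupBound

/-! ### Comparison of the modular with `L^q` and `L^∞` norms -/

section Modular

/-- The growth of `t^(p-q)` absorbs the division by `p`: for `t ≥ e` one has `t^(p-q) ≥ 1 + (p-q)`,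
and `q(1 + p - q) ≥ p` because `q ≥ 1`. The constant `q` is thus independent of `p`. -/
theorem rpow_le_mul_rpow_div {q p t : ℝ} (hq : 1 ≤ q) (hqp : q ≤ p) (ht : Real.exp 1 ≤ t) :
    t ^ q ≤ q * (t ^ p / p) := by
  have ht0 : 0 < t := (Real.exp_pos 1).trans_le ht
  have h1 : 1 + (p - q) ≤ t ^ (p - q) := by
    calc 1 + (p - q) ≤ Real.exp (p - q) := by linarith [Real.add_one_le_exp (p - q)]
      _ = Real.exp 1 ^ (p - q) := by rw [← Real.exp_mul, one_mul]
      _ ≤ t ^ (p - q) := Real.rpow_le_rpow (Real.exp_pos 1).le ht (by linarith)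
  have h2 : t ^ p = t ^ q * t ^ (p - q) := by rw [← Real.rpow_add ht0]; congr 1; ring
  have h3 : p ≤ q * t ^ (p - q) := by nlinarith
  rw [h2, mul_div_assoc', le_div_iff₀ (by linarith)]
  nlinarith [Real.rpow_nonneg ht0.le q]

/-- Used where `p ≤ N`. Values `t ≤ η` cost `η`, values `t ≥ e` are covered by
`rpow_le_mul_rpow_div`, and in between `t^p / p ≥ η^N / N` while `t^q ≤ e^q`. -/
theorem rpow_le_add_mul_rpow_div {q p t η N : ℝ} (hq : 1 ≤ q) (hqp : q ≤ p) (ht : 0 ≤ t)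
    (hη : 0 < η) (hη1 : η ≤ 1) (hpN : p ≤ N) :
    t ^ q ≤ η + (q + Real.exp 1 ^ q * (N / η ^ N)) * (t ^ p / p) := by
  have hp0 : 0 < p := by linarith
  have hN0 : 0 < N := by linarith
  have hA : 0 ≤ t ^ p / p := div_nonneg (Real.rpow_nonneg ht p) hp0.le
  have hB : 0 ≤ Real.exp 1 ^ q * (N / η ^ N) := by positivity
  rcases le_total (Real.exp 1) t with h | h
  · have := rpow_le_mul_rpow_div hq hqp h
    nlinarith
  rcases le_total t η with h' | h'
  · have : t ^ q ≤ η := calc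
      t ^ q ≤ η ^ q := Real.rpow_le_rpow ht h' (by linarith)
      _ ≤ η ^ (1 : ℝ) := Real.rpow_le_rpow_of_exponent_ge hη hη1 hq
      _ = η := Real.rpow_one η
    have : 0 ≤ (q + Real.exp 1 ^ q * (N / η ^ N)) * (t ^ p / p) := by positivity
    linarith
  · have h1 : η ^ N / N ≤ t ^ p / p := by
      have h2 : η ^ N ≤ t ^ p := (Real.rpow_le_rpow_of_exponent_ge hη hη1 hpN).trans
        (Real.rpow_le_rpow hη.le h' hp0.le)
      exact div_le_div₀ (Real.rpow_nonneg ht p) h2 hp0 hpN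
    have h3 : 1 ≤ N / η ^ N * (t ^ p / p) := by
      calc (1 : ℝ) = N / η ^ N * (η ^ N / N) := by
            have : 0 < η ^ N := Real.rpow_pos_of_pos hη N
            field_simp
        _ ≤ _ := by gcongr
    have h4 : t ^ q ≤ Real.exp 1 ^ q := Real.rpow_le_rpow ht h (by linarith)
    have h5 : 0 < Real.exp 1 ^ q := Real.rpow_pos_of_pos (Real.exp_pos 1) q
    have h6 : 0 ≤ q * (t ^ p / p) := by positivity
    nlinarith

/-- Used where `p > N`: no upper bound on `p` enters, and the additive constant is harmless on a set
of small measure. -/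
theorem rpow_le_exp_rpow_add {q p t : ℝ} (hq : 1 ≤ q) (hqp : q ≤ p) (ht : 0 ≤ t) :
    t ^ q ≤ Real.exp 1 ^ q + q * (t ^ p / p) := by
  have hA : 0 ≤ t ^ p / p := div_nonneg (Real.rpow_nonneg ht p) (by linarith)
  have h5 : 0 < Real.exp 1 ^ q := Real.rpow_pos_of_pos (Real.exp_pos 1) q
  rcases le_total (Real.exp 1) t with h | h
  · linarith [rpow_le_mul_rpow_div hq hqp h]
  · have h4 : t ^ q ≤ Real.exp 1 ^ q := Real.rpow_le_rpow ht h (by linarith)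
    nlinarith

variable {n : ℕ} {Ω : Set (EuclideanSpace ℝ (Fin n))} {p : EuclideanSpace ℝ (Fin n) → ℝ} {q : ℝ}

theorem exists_measure_inter_lt_le (hΩ : IsOpen Ω) (hΩt : volume Ω ≠ ⊤) (hp : ContinuousOn p Ω)
    {ε : ℝ≥0∞} (hε : ε ≠ 0) : ∃ N : ℝ, 1 ≤ N ∧ volume (Ω ∩ {x | N < p x}) ≤ ε := by
  have hm : ∀ N : ℕ, NullMeasurableSet (Ω ∩ {x | (N : ℝ) < p x}) volume := fun N =>
    (hp.isOpen_inter_preimage hΩ isOpen_Ioi).nullMeasurableSet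
  have h1 : Tendsto (fun N : ℕ => volume (Ω ∩ {x | (N : ℝ) < p x})) atTop
      (𝓝 (volume (⋂ N : ℕ, Ω ∩ {x | (N : ℝ) < p x}))) := by
    refine tendsto_measure_iInter_atTop hm (fun a b hab x hx => ⟨hx.1, ?_⟩)
      ⟨0, ((measure_mono inter_subset_left).trans_lt hΩt.lt_top).ne⟩
    have h2 : (b : ℝ) < p x := hx.2
    exact (Nat.cast_le.2 hab).trans_lt h2
  have h2 : (⋂ N : ℕ, Ω ∩ {x | (N : ℝ) < p x}) = ∅ := by
    refine eq_empty_of_forall_notMem fun x hx => ?_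
    obtain ⟨N, hN⟩ := exists_nat_gt (p x)
    exact lt_asymm hN (mem_iInter.1 hx N).2
  rw [h2, measure_empty] at h1
  obtain ⟨N, hN, hN1⟩ := ((h1.eventually_le_const (pos_iff_ne_zero.2 hε)).and
    (eventually_ge_atTop 1)).exists
  exact ⟨N, by exact_mod_cast hN1, hN⟩

/-- A small modular forces a small `L^q` norm, even if `p` is unbounded. -/
theorem exists_eLpNorm_le_of_lpModular_le (hΩ : IsOpen Ω) (hΩt : volume Ω ≠ ⊤)
    (hp : ContinuousOn p Ω) (hq : 1 ≤ q) (hqp : ∀ x ∈ Ω, q ≤ p x) {ε : ℝ≥0∞} (hε : ε ≠ 0) :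
    ∃ δ : ℝ≥0∞, δ ≠ 0 ∧ ∀ w : EuclideanSpace ℝ (Fin n) → ℝ, lpModular Ω p w ≤ δ →
      eLpNorm w (ENNReal.ofReal q) (volume.restrict Ω) ≤ ε := by
  have hq0 : 0 < q := by linarith
  -- One third of `ε^q` is allotted to each error: `η` times the volume of `Ω`, the constant `e^q`
  -- on `{p > N}`, and the multiple `C` of the modular. As `C` depends on `η` and `N`, `δ` is chosen
  -- last.
  set κ : ℝ≥0∞ := min (ε ^ q) 1 / 3 with hκ
  have hκ0 : κ ≠ 0 := by
    refine (ENNReal.div_pos ?_ (by simp)).ne'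
    exact (lt_min (ENNReal.rpow_pos_of_nonneg (pos_iff_ne_zero.2 hε) hq0.le) one_pos).ne'
  have hκε : κ + κ + κ ≤ ε ^ q := by
    rw [hκ, ENNReal.add_thirds]
    exact min_le_left _ _
  obtain ⟨η, hη, hη1, hηκ⟩ : ∃ η : ℝ, 0 < η ∧ η ≤ 1 ∧ ENNReal.ofReal η * volume Ω ≤ κ := by
    have h1 : Tendsto (fun η : ℝ => ENNReal.ofReal η * volume Ω) (𝓝[>] 0) (𝓝 0) := by
      have h2 : Tendsto (fun η : ℝ => ENNReal.ofReal η) (𝓝[>] 0) (𝓝 (ENNReal.ofReal 0)) :=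
        (ENNReal.tendsto_ofReal tendsto_id).mono_left nhdsWithin_le_nhds
      rw [ENNReal.ofReal_zero] at h2
      simpa using ENNReal.Tendsto.mul_const h2 (Or.inr hΩt)
    have h3 : ∀ᶠ η : ℝ in 𝓝[>] 0, η ∈ Ioc (0 : ℝ) 1 := Ioc_mem_nhdsGT zero_lt_one
    obtain ⟨η, h4, h5⟩ := ((h1.eventually_le_const (pos_iff_ne_zero.2 hκ0)).and h3).exists
    exact ⟨η, h5.1, h5.2, h4⟩
  set L : ℝ := Real.exp 1 ^ q with hL
  have hL0 : 0 < L := Real.rpow_pos_of_pos (Real.exp_pos 1) q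
  obtain ⟨N, hN1, hN⟩ := exists_measure_inter_lt_le hΩ hΩt hp
    (ENNReal.div_pos hκ0 (ENNReal.ofReal_ne_top (r := L))).ne'
  set C : ℝ := q + L * (N / η ^ N) with hC
  have hCq : q ≤ C := by
    have : 0 ≤ L * (N / η ^ N) := by positivity
    linarith
  have hC0 : 0 < C := by linarith
  refine ⟨κ / ENNReal.ofReal C, (ENNReal.div_pos hκ0 ENNReal.ofReal_ne_top).ne', fun w hw => ?_⟩
  have hT : MeasurableSet (Ω ∩ {x | N < p x}) :=
    (hp.isOpen_inter_preimage hΩ isOpen_Ioi).measurableSet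
  have hpt : ∀ x ∈ Ω, ‖w x‖ₑ ^ q ≤ ENNReal.ofReal η
      + (Ω ∩ {x | N < p x}).indicator (fun _ => ENNReal.ofReal L) x
      + ENNReal.ofReal C * ENNReal.ofReal (|w x| ^ p x / p x) := by
    intro x hx
    have hpx := hqp x hx
    have hA : 0 ≤ |w x| ^ p x / p x :=
      div_nonneg (Real.rpow_nonneg (abs_nonneg _) _) (by linarith)
    rw [← ofReal_norm, ENNReal.ofReal_rpow_of_nonneg (norm_nonneg _) hq0.le, Real.norm_eq_abs,
      ← ENNReal.ofReal_mul hC0.le]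
    by_cases hxN : N < p x
    · rw [indicator_of_mem (show x ∈ Ω ∩ {x | N < p x} from ⟨hx, hxN⟩),
        ← ENNReal.ofReal_add hη.le hL0.le,
        ← ENNReal.ofReal_add (by positivity) (mul_nonneg hC0.le hA)]
      refine ENNReal.ofReal_le_ofReal ?_
      have := rpow_le_exp_rpow_add hq hpx (abs_nonneg (w x))
      nlinarith
    · rw [indicator_of_notMem (show x ∉ Ω ∩ {x | N < p x} from fun h => hxN h.2), add_zero,
        ← ENNReal.ofReal_add hη.le (mul_nonneg hC0.le hA)]
      exact ENNReal.ofReal_le_ofReal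
        (rpow_le_add_mul_rpow_div hq hpx (abs_nonneg (w x)) hη hη1 (not_lt.1 hxN))
  have hint : ∫⁻ x in Ω, ‖w x‖ₑ ^ q ≤ ε ^ q := by
    refine (setLIntegral_mono' hΩ.measurableSet hpt).trans (le_trans ?_ hκε)
    have hTm : Measurable ((Ω ∩ {x | N < p x}).indicator fun _ => ENNReal.ofReal L) :=
      measurable_const.indicator hT
    rw [lintegral_add_left (by fun_prop),
      lintegral_add_left measurable_const, lintegral_const_mul' _ _ ENNReal.ofReal_ne_top,
      lintegral_indicator_const hT, lintegral_const, Measure.restrict_apply_univ]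
    refine add_le_add (add_le_add hηκ ?_) ?_
    · calc ENNReal.ofReal L * volume.restrict Ω (Ω ∩ {x | N < p x})
          ≤ ENNReal.ofReal L * (κ / ENNReal.ofReal L) := by
            gcongr
            exact (Measure.restrict_apply_le _ _).trans hN
        _ ≤ κ := ENNReal.mul_div_le
    · calc ENNReal.ofReal C * ∫⁻ x in Ω, ENNReal.ofReal (|w x| ^ p x / p x)
          ≤ ENNReal.ofReal C * (κ / ENNReal.ofReal C) := by gcongr; exact hw
        _ ≤ κ := ENNReal.mul_div_le
  rw [eLpNorm_eq_lintegral_rpow_enorm_toReal (by simpa using hq0) ENNReal.ofReal_ne_top,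
    ENNReal.toReal_ofReal hq0.le, one_div, ENNReal.rpow_inv_le_iff hq0]
  exact hint

theorem tendsto_eLpNorm_of_tendsto_lpModular (hΩ : IsOpen Ω) (hΩt : volume Ω ≠ ⊤)
    (hp : ContinuousOn p Ω) (hq : 1 ≤ q) (hqp : ∀ x ∈ Ω, q ≤ p x) {ι F : Type*}
    [NormedAddCommGroup F] {l : Filter ι} {w : ι → EuclideanSpace ℝ (Fin n) → F}
    (hw : Tendsto (fun i => lpModular Ω p fun x => ‖w i x‖) l (𝓝 0)) :
    Tendsto (fun i => eLpNorm (w i) (ENNReal.ofReal q) (volume.restrict Ω)) l (𝓝 0) := by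
  refine ENNReal.tendsto_nhds_zero.2 fun ε hε => ?_
  obtain ⟨δ, hδ, h⟩ := exists_eLpNorm_le_of_lpModular_le hΩ hΩt hp hq hqp hε.ne'
  filter_upwards [ENNReal.tendsto_nhds_zero.1 hw δ (pos_iff_ne_zero.2 hδ)] with i hi
  rw [← eLpNorm_norm]
  exact h _ hi

theorem lpModular_congr_ae {u v : EuclideanSpace ℝ (Fin n) → ℝ}
    (h : u =ᵐ[volume.restrict Ω] v) : lpModular Ω p u = lpModular Ω p v :=
  lintegral_congr_ae (h.mono fun x hx => by simp only [hx])

theorem lpModular_abs (u : EuclideanSpace ℝ (Fin n) → ℝ) :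
    lpModular Ω p (fun x => |u x|) = lpModular Ω p u := by
  simp [lpModular]

/-- A weak form of convexity of the modular. -/
theorem lpModular_le_add_of_le (hΩ : MeasurableSet Ω) (hp : ContinuousOn p Ω)
    (hp0 : ∀ x ∈ Ω, 0 < p x) {u v w : EuclideanSpace ℝ (Fin n) → ℝ}
    (hu : AEMeasurable u (volume.restrict Ω))
    (h : ∀ᵐ x ∂volume.restrict Ω, |w x| ≤ max |u x| |v x|) :
    lpModular Ω p w ≤ lpModular Ω p u + lpModular Ω p v := by
  have hpm : AEMeasurable p (volume.restrict Ω) := hp.aemeasurable hΩ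
  unfold lpModular
  rw [← lintegral_add_left' (by fun_prop)]
  refine lintegral_mono_ae ?_
  filter_upwards [h, ae_restrict_mem hΩ] with x hx hxΩ
  have hpx := hp0 x hxΩ
  have key : ∀ a b : ℝ, |a| ≤ |b| → ENNReal.ofReal (|a| ^ p x / p x)
      ≤ ENNReal.ofReal (|b| ^ p x / p x) := fun a b hab =>
    ENNReal.ofReal_le_ofReal (div_le_div_of_nonneg_right
      (Real.rpow_le_rpow (abs_nonneg a) hab hpx.le) hpx.le)
  rcases le_max_iff.1 hx with h | h
  · exact (key _ _ h).trans le_self_add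
  · exact (key _ _ h).trans le_add_self

/-- For `0 ≤ s ≤ 1` and `p ≥ 1`, `s^p / p ≤ s`, however large `p` is. -/
theorem lpModular_le_of_eLpNorm_top_le (hΩ : MeasurableSet Ω) (hp : ∀ x ∈ Ω, 1 ≤ p x)
    {u : EuclideanSpace ℝ (Fin n) → ℝ} {t : ℝ≥0∞} (ht : t ≤ 1)
    (hu : eLpNorm u ⊤ (volume.restrict Ω) ≤ t) : lpModular Ω p u ≤ t * volume Ω := by
  rw [eLpNorm_exponent_top] at hu
  unfold lpModular
  rw [← Measure.restrict_apply_univ, ← lintegral_const]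
  refine lintegral_mono_ae ?_
  filter_upwards [ae_le_eLpNormEssSup (f := u) (μ := volume.restrict Ω), ae_restrict_mem hΩ]
    with x hx hxΩ
  have hpx := hp x hxΩ
  have hxt : ‖u x‖ₑ ≤ t := hx.trans hu
  refine le_trans ?_ hxt
  have h1 : |u x| ≤ 1 := by
    have := hxt.trans ht
    rwa [← ofReal_norm, ENNReal.ofReal_le_one] at this
  rw [← ofReal_norm, Real.norm_eq_abs]
  refine ENNReal.ofReal_le_ofReal ?_
  calc |u x| ^ p x / p x ≤ |u x| ^ p x := div_le_self (by positivity) hpx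
    _ ≤ |u x| ^ (1 : ℝ) := by
      rcases (abs_nonneg (u x)).eq_or_lt with h0 | h0
      · rw [← h0, Real.zero_rpow (by linarith), Real.zero_rpow one_ne_zero]
      · exact Real.rpow_le_rpow_of_exponent_ge h0 h1 hpx
    _ = |u x| := Real.rpow_one _

/-- Fatou's lemma for the modular. -/
theorem lpModular_le_of_tendsto_ae (hΩ : MeasurableSet Ω) (hp : ContinuousOn p Ω)
    (hp0 : ∀ x ∈ Ω, 0 < p x) {u : ℕ → EuclideanSpace ℝ (Fin n) → ℝ}
    {w : EuclideanSpace ℝ (Fin n) → ℝ} (hu : ∀ k, AEMeasurable (u k) (volume.restrict Ω))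
    (h : ∀ᵐ x ∂volume.restrict Ω, Tendsto (fun k => u k x) atTop (𝓝 (w x)))
    {ε : ℝ≥0∞} (hε : ∀ᶠ k in atTop, lpModular Ω p (u k) ≤ ε) : lpModular Ω p w ≤ ε := by
  have hpm : AEMeasurable p (volume.restrict Ω) := hp.aemeasurable hΩ
  calc lpModular Ω p w
      = ∫⁻ x in Ω, liminf (fun k => ENNReal.ofReal (|u k x| ^ p x / p x)) atTop := by
        refine lintegral_congr_ae ?_
        filter_upwards [h, ae_restrict_mem hΩ] with x hx hxΩ
        refine (Tendsto.liminf_eq ?_).symm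
        refine ENNReal.tendsto_ofReal (Tendsto.div_const ?_ _)
        exact (hx.abs).rpow_const (Or.inr (hp0 x hxΩ).le)
    _ ≤ liminf (fun k => lpModular Ω p (u k)) atTop :=
        lintegral_liminf_le' fun k => by
          have := hu k
          fun_prop
    _ ≤ ε := liminf_le_of_frequently_le' hε.frequently

end Modular

/-! ### Weak gradients -/

section WeakGradient

variable {n : ℕ} {Ω : Set (EuclideanSpace ℝ (Fin n))}

theorem integrable_mul_of_locallyIntegrableOn {f g : EuclideanSpace ℝ (Fin n) → ℝ}
    (hf : LocallyIntegrableOn f Ω) (hg : Continuous g) (hc : HasCompactSupport g)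
    (hs : tsupport g ⊆ Ω) : Integrable (fun x => f x * g x) (volume.restrict Ω) := by
  have h1 : IntegrableOn (fun x => f x * g x) (tsupport g) :=
    (hf.integrableOn_compact_subset hs hc).mul_continuousOn hg.continuousOn hc
  refine ((integrableOn_iff_integrable_of_support_subset fun x hx => ?_).1 h1).integrableOn
  exact subset_tsupport g fun h => hx (by simp [h])

theorem IsTestFunction.integrable_mul {φ f : EuclideanSpace ℝ (Fin n) → ℝ}
    (hφ : IsTestFunction Ω φ) (hf : LocallyIntegrableOn f Ω) :
    Integrable (fun x => f x * φ x) (volume.restrict Ω) :=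
  integrable_mul_of_locallyIntegrableOn hf hφ.1.continuous hφ.2.1 hφ.2.2

theorem IsTestFunction.fderiv_apply {φ : EuclideanSpace ℝ (Fin n) → ℝ}
    (hφ : IsTestFunction Ω φ) (e : EuclideanSpace ℝ (Fin n)) :
    IsTestFunction Ω fun x => fderiv ℝ φ x e := by
  refine ⟨(hφ.1.fderiv_right (m := ∞) (by simp)).clm_apply contDiff_const,
    hφ.2.1.fderiv_apply ℝ e, (tsupport_fderiv_apply_subset ℝ e).trans hφ.2.2⟩

theorem IsTestFunction.sub {φ ψ : EuclideanSpace ℝ (Fin n) → ℝ} (hφ : IsTestFunction Ω φ)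
    (hψ : IsTestFunction Ω ψ) : IsTestFunction Ω (φ - ψ) := by
  refine ⟨hφ.1.sub hψ.1, ?_, ?_⟩
  · exact hφ.2.1.sub hψ.2.1
  · exact (tsupport_sub φ ψ).trans (union_subset hφ.2.2 hψ.2.2)

theorem MeasureTheory.LocallyIntegrableOn.coord {g : EuclideanSpace ℝ (Fin n) → EuclideanSpace ℝ (Fin n)}
    (hg : LocallyIntegrableOn g Ω) (i : Fin n) : LocallyIntegrableOn (fun x => g x i) Ω :=
  (EuclideanSpace.proj i : EuclideanSpace ℝ (Fin n) →L[ℝ] ℝ).locallyIntegrableOn_comp hg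

namespace HasWeakGradient

variable {u u' : EuclideanSpace ℝ (Fin n) → ℝ}
  {g g' : EuclideanSpace ℝ (Fin n) → EuclideanSpace ℝ (Fin n)}

theorem congr_ae (h : HasWeakGradient Ω u g) (hu : u =ᵐ[volume.restrict Ω] u')
    (hg : g =ᵐ[volume.restrict Ω] g') : HasWeakGradient Ω u' g' := by
  refine ⟨h.1.congr hu, h.2.1.congr hg, fun φ hφ i => ?_⟩
  rw [← integral_congr_ae (hu.mono fun x hx => ?_), h.2.2 φ hφ i,
    integral_congr_ae (hg.mono fun x hx => ?_)]
  · simp only [hx]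
  · simp only [hx]

theorem sub (h : HasWeakGradient Ω u g) (h' : HasWeakGradient Ω u' g') :
    HasWeakGradient Ω (u - u') (g - g') := by
  refine ⟨h.1.sub h'.1, h.2.1.sub h'.2.1, fun φ hφ i => ?_⟩
  have hd := hφ.fderiv_apply (EuclideanSpace.single i 1)
  simp only [Pi.sub_apply, PiLp.sub_apply, sub_mul]
  rw [integral_sub (hd.integrable_mul h.1) (hd.integrable_mul h'.1),
    integral_sub (hφ.integrable_mul (h.2.1.coord i)) (hφ.integrable_mul (h'.2.1.coord i)),
    h.2.2 φ hφ i, h'.2.2 φ hφ i]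
  ring

theorem const_smul (h : HasWeakGradient Ω u g) (c : ℝ) :
    HasWeakGradient Ω (c • u) (c • g) := by
  refine ⟨h.1.smul c, h.2.1.smul c, fun φ hφ i => ?_⟩
  simp only [Pi.smul_apply, PiLp.smul_apply, smul_eq_mul, mul_assoc]
  rw [integral_const_mul, integral_const_mul, h.2.2 φ hφ i]
  ring

/-- Fundamental lemma of the calculus of variations in each coordinate. It frees later arguments
from the particular choice made in `weakGradient`. -/
theorem ae_eq (hΩ : IsOpen Ω) (h : HasWeakGradient Ω u g) (h' : HasWeakGradient Ω u' g')
    (hu : u =ᵐ[volume.restrict Ω] u') : g =ᵐ[volume.restrict Ω] g' := by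
  have hd := h.sub h'
  have hcoord : ∀ i, ∀ᵐ x, x ∈ Ω → (g - g') x i = 0 := by
    intro i
    refine hΩ.ae_eq_zero_of_integral_contDiff_smul_eq_zero (hd.2.1.coord i) fun φ h1 h2 h3 => ?_
    have h4 := hd.2.2 φ ⟨h1, h2, h3⟩ i
    have h5 : ∫ x in Ω, (u - u') x * fderiv ℝ φ x (EuclideanSpace.single i 1) = 0 := by
      rw [← integral_zero (EuclideanSpace ℝ (Fin n)) ℝ (μ := volume.restrict Ω)]
      exact integral_congr_ae (hu.mono fun x hx => by simp [hx])
    rw [h5, eq_comm, neg_eq_zero] at h4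
    rw [← setIntegral_eq_integral_of_forall_compl_eq_zero (s := Ω), ← h4]
    · exact integral_congr_ae (Eventually.of_forall fun x => by simp [mul_comm])
    · intro x hx
      rw [image_eq_zero_of_notMem_tsupport fun h => hx (h3 h), zero_smul]
  rw [EventuallyEq, ae_restrict_iff' hΩ.measurableSet]
  filter_upwards [ae_all_iff.2 hcoord] with x hx hxΩ
  ext i
  simpa [sub_eq_zero] using hx i hxΩ

/-- Test functions and their derivatives are bounded, so `L^1` convergence passes to the limit on
both sides of the defining identity. -/
theorem of_tendsto [IsFiniteMeasure (volume.restrict Ω)] {U : ℕ → EuclideanSpace ℝ (Fin n) → ℝ}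
    {G : ℕ → EuclideanSpace ℝ (Fin n) → EuclideanSpace ℝ (Fin n)}
    (h : ∀ j, HasWeakGradient Ω (U j) (G j)) (hu : Integrable u (volume.restrict Ω))
    (hg : Integrable g (volume.restrict Ω))
    (hU : Tendsto (fun j => eLpNorm (U j - u) 1 (volume.restrict Ω)) atTop (𝓝 0))
    (hG : Tendsto (fun j => eLpNorm (G j - g) 1 (volume.restrict Ω)) atTop (𝓝 0)) :
    HasWeakGradient Ω u g := by
  have hul : LocallyIntegrableOn u Ω := IntegrableOn.locallyIntegrableOn hu
  have hgl : LocallyIntegrableOn g Ω := IntegrableOn.locallyIntegrableOn hg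
  have key : ∀ (f : EuclideanSpace ℝ (Fin n) → ℝ) (F : ℕ → EuclideanSpace ℝ (Fin n) → ℝ) ψ,
      IsTestFunction Ω ψ → LocallyIntegrableOn f Ω → (∀ j, LocallyIntegrableOn (F j) Ω) →
      Tendsto (fun j => eLpNorm (F j - f) 1 (volume.restrict Ω)) atTop (𝓝 0) →
      Tendsto (fun j => ∫ x in Ω, F j x * ψ x) atTop (𝓝 (∫ x in Ω, f x * ψ x)) := by
    intro f F ψ hψ hf hF hFf
    obtain ⟨M, hM⟩ := hψ.1.continuous.bounded_above_of_compact_support hψ.2.1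
    refine tendsto_integral_of_L1' _ (hψ.integrable_mul hf).aestronglyMeasurable
      (Eventually.of_forall fun j => hψ.integrable_mul (hF j)) ?_
    refine tendsto_of_tendsto_of_tendsto_of_le_of_le tendsto_const_nhds
      (h := fun j => ENNReal.ofReal M * eLpNorm (F j - f) 1 (volume.restrict Ω)) ?_
      (fun _ => zero_le) fun j => ?_
    · simpa using ENNReal.Tendsto.const_mul hFf (Or.inr ENNReal.ofReal_ne_top)
    · refine eLpNorm_le_mul_eLpNorm_of_ae_le_mul (Eventually.of_forall fun x => ?_) 1
      simp only [Pi.sub_apply, ← sub_mul, norm_mul]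
      rw [mul_comm]
      gcongr
      exact hM x
  refine ⟨hul, hgl, fun φ hφ i => ?_⟩
  have h1 := key u U _ (hφ.fderiv_apply (EuclideanSpace.single i 1)) hul (fun j => (h j).1) hU
  have h2 := key (fun x => g x i) (fun j x => G j x i) φ hφ (hgl.coord i)
    (fun j => (h j).2.1.coord i) ?_
  · refine tendsto_nhds_unique h1 (h2.neg.congr fun j => ?_)
    rw [(h j).2.2 φ hφ i]
  · refine tendsto_of_tendsto_of_tendsto_of_le_of_le tendsto_const_nhds hG
      (fun _ => zero_le) fun j => ?_
    exact eLpNorm_mono fun x => by simpa using PiLp.norm_apply_le (G j x - g x) i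

end HasWeakGradient

theorem hasWeakGradient_weakGradient {u : EuclideanSpace ℝ (Fin n) → ℝ}
    (h : ∃ g, HasWeakGradient Ω u g) : HasWeakGradient Ω u (weakGradient Ω u) := by
  rw [weakGradient, dif_pos h]
  exact h.choose_spec

theorem norm_gradient_eq (φ : EuclideanSpace ℝ (Fin n) → ℝ) (x : EuclideanSpace ℝ (Fin n)) :
    ‖gradient φ x‖ = ‖fderiv ℝ φ x‖ := by
  simp [gradient]

theorem gradient_apply (φ : EuclideanSpace ℝ (Fin n) → ℝ) (x : EuclideanSpace ℝ (Fin n))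
    (i : Fin n) : gradient φ x i = fderiv ℝ φ x (EuclideanSpace.single i 1) := by
  have h := InnerProductSpace.toDual_symm_apply (𝕜 := ℝ) (x := EuclideanSpace.single i (1 : ℝ))
    (y := fderiv ℝ φ x)
  rw [← h, EuclideanSpace.inner_single_right]
  simp [gradient]

theorem IsTestFunction.continuous_gradient {φ : EuclideanSpace ℝ (Fin n) → ℝ}
    (hφ : IsTestFunction Ω φ) : Continuous (gradient φ) :=
  (InnerProductSpace.toDual ℝ (EuclideanSpace ℝ (Fin n))).symm.continuous.comp
    (hφ.1.continuous_fderiv (by simp))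

theorem IsTestFunction.hasCompactSupport_gradient {φ : EuclideanSpace ℝ (Fin n) → ℝ}
    (hφ : IsTestFunction Ω φ) : HasCompactSupport (gradient φ) :=
  (hφ.2.1.fderiv ℝ).comp_left (map_zero (InnerProductSpace.toDual ℝ (EuclideanSpace ℝ (Fin n))).symm)

theorem IsTestFunction.gradient_sub {φ ψ : EuclideanSpace ℝ (Fin n) → ℝ}
    (hφ : IsTestFunction Ω φ) (hψ : IsTestFunction Ω ψ) :
    gradient (φ - ψ) = gradient φ - gradient ψ := by
  ext x i
  rw [Pi.sub_apply, PiLp.sub_apply, gradient_apply, gradient_apply, gradient_apply,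
    fderiv_sub (hφ.1.differentiable (by simp) x) (hψ.1.differentiable (by simp) x)]
  simp

theorem IsTestFunction.hasWeakGradient {φ : EuclideanSpace ℝ (Fin n) → ℝ}
    (hφ : IsTestFunction Ω φ) : HasWeakGradient Ω φ (gradient φ) := by
  have hl : LocallyIntegrable φ := hφ.1.continuous.locallyIntegrable
  refine ⟨hl.locallyIntegrableOn _, hφ.continuous_gradient.locallyIntegrable.locallyIntegrableOn _,
    fun ψ hψ i => ?_⟩
  have hd := hφ.fderiv_apply (EuclideanSpace.single i 1)
  have hd' := hψ.fderiv_apply (EuclideanSpace.single i 1)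
  simp only [gradient_apply]
  rw [setIntegral_eq_integral_of_forall_compl_eq_zero, setIntegral_eq_integral_of_forall_compl_eq_zero]
  · refine integral_mul_fderiv_eq_neg_fderiv_mul_of_integrable ?_ ?_ ?_
      (fun x _ => hφ.1.differentiable (by simp) x) (fun x _ => hψ.1.differentiable (by simp) x)
    · exact (hd.1.continuous.mul hψ.1.continuous).integrable_of_hasCompactSupport hψ.2.1.mul_left
    · exact (hφ.1.continuous.mul hd'.1.continuous).integrable_of_hasCompactSupport hd'.2.1.mul_left
    · exact (hφ.1.continuous.mul hψ.1.continuous).integrable_of_hasCompactSupport hψ.2.1.mul_left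
  · intro x hx
    rw [image_eq_zero_of_notMem_tsupport fun h => hx (hψ.2.2 h), mul_zero]
  · intro x hx
    rw [image_eq_zero_of_notMem_tsupport fun h => hx (hφ.2.2 h), zero_mul]

variable {p : EuclideanSpace ℝ (Fin n) → ℝ}

theorem sobolevModular_eq (hΩ : IsOpen Ω) {u : MeasurableClass Ω}
    {f : EuclideanSpace ℝ (Fin n) → ℝ} {g : EuclideanSpace ℝ (Fin n) → EuclideanSpace ℝ (Fin n)}
    (hu : u =ᵐ[volume.restrict Ω] f) (h : HasWeakGradient Ω f g) :
    sobolevModular Ω p u = lpModular Ω p f + lpModular Ω p fun x => ‖g x‖ := by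
  have h' : HasWeakGradient Ω u g := h.congr_ae hu.symm EventuallyEq.rfl
  have hw := (hasWeakGradient_weakGradient ⟨g, h'⟩).ae_eq hΩ h' EventuallyEq.rfl
  rw [sobolevModular, if_pos ⟨g, h'⟩, lpModular_congr_ae hu]
  congr 1
  exact lpModular_congr_ae (hw.mono fun x hx => by simp only [hx])

/-- The modular is `⊤` without a weak gradient, so finiteness at `c • u` provides a gradient of `c •
u`, which is scaled back by `c⁻¹`. -/
theorem hasWeakGradient_of_mem_sobolevSpace {u : MeasurableClass Ω} (hu : u ∈ sobolevSpace Ω p) :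
    HasWeakGradient Ω u (weakGradient Ω u) := by
  obtain ⟨c, hc, h⟩ := hu
  refine hasWeakGradient_weakGradient ?_
  by_cases hg : ∃ g, HasWeakGradient Ω (c • u : MeasurableClass Ω) g
  · obtain ⟨g, hg⟩ := hg
    refine ⟨_, (hg.const_smul c⁻¹).congr_ae ?_ EventuallyEq.rfl⟩
    filter_upwards [AEEqFun.coeFn_smul c u] with x hx
    rw [Pi.smul_apply, hx, Pi.smul_apply, smul_smul, inv_mul_cancel₀ hc.ne', one_smul]
  · rw [sobolevModular, if_neg hg] at h
    exact absurd h (lt_irrefl _)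

end WeakGradient

/-! ### Modular closure and modular topology -/

section ModularTopology

variable {X : Type*} [AddCommGroup X] [Module ℝ X] {ρ : X → ℝ≥0∞}

theorem isModularClosed_modularClosure (A : Set (modularSpace ρ)) :
    IsModularClosed ρ (modularClosure ρ A) :=
  fun x y hx hxy F hF => hF.1 x y (fun j => hx j F hF) hxy

/-- Otherwise a subsequence would stay in the closed complement of a neighbourhood of `y`, which
would then contain its modular limit `y`. -/
theorem ModularTendsto.tendsto_modularTopology {x : ℕ → modularSpace ρ} {y : modularSpace ρ}
    (h : ModularTendsto ρ (fun j => (x j : X)) y) :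
    Tendsto x atTop (@nhds _ (modularTopology ρ) y) := by
  let := modularTopology ρ
  refine tendsto_nhds.2 fun s hs hys => ?_
  by_contra hcon
  obtain ⟨k, hk, hks⟩ := extraction_of_frequently_atTop (not_eventually.1 hcon)
  have hsc : IsModularClosed ρ sᶜ := hs
  exact hsc (x ∘ k) y hks (h.comp hk.tendsto_atTop) hys

end ModularTopology

/-! ### Completeness and inclusions of `L^Q` spaces -/

theorem exists_memLp_tendsto_eLpNorm_of_cauchy {α F : Type*} [MeasurableSpace α] {μ : Measure α}
    [NormedAddCommGroup F] [CompleteSpace F] {Q : ℝ≥0∞} (hQ : 1 ≤ Q) {f : ℕ → α → F}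
    (hf : ∀ j, MemLp (f j) Q μ)
    (h : Tendsto (fun jk : ℕ × ℕ => eLpNorm (f jk.1 - f jk.2) Q μ) atTop (𝓝 0)) :
    ∃ g, MemLp g Q μ ∧ Tendsto (fun j => eLpNorm (f j - g) Q μ) atTop (𝓝 0) := by
  have : Fact (1 ≤ Q) := ⟨hQ⟩
  have hc : CauchySeq fun j => (hf j).toLp (f j) := by
    refine EMetric.cauchySeq_iff.2 fun ε hε => ?_
    obtain ⟨N, hN⟩ := eventually_atTop_prod_self'.1 (h.eventually_lt_const hε)
    refine ⟨N, fun j hj k hk => ?_⟩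
    rw [Lp.edist_toLp_toLp]
    exact hN j hj k hk
  obtain ⟨g, hg⟩ := cauchySeq_tendsto_of_complete hc
  refine ⟨g, Lp.memLp g, ?_⟩
  rw [← Lp.toLp_coeFn g (Lp.memLp g)] at hg
  exact (Lp.tendsto_Lp_iff_tendsto_eLpNorm'' f hf g (Lp.memLp g)).1 hg

theorem tendsto_eLpNorm_of_exponent_le {α ι F : Type*} [MeasurableSpace α] {μ : Measure α}
    [IsFiniteMeasure μ] [NormedAddCommGroup F] {P Q : ℝ≥0∞} (hP : 1 ≤ P) (hPQ : P ≤ Q)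
    {l : Filter ι} {f : ι → α → F} (hf : ∀ i, AEStronglyMeasurable (f i) μ)
    (h : Tendsto (fun i => eLpNorm (f i) Q μ) l (𝓝 0)) :
    Tendsto (fun i => eLpNorm (f i) P μ) l (𝓝 0) := by
  have hexp : 0 ≤ 1 / P.toReal - 1 / Q.toReal := by
    rcases eq_or_ne Q ⊤ with rfl | hQ
    · simp
    have h1 : 0 < P.toReal := ENNReal.toReal_pos (zero_lt_one.trans_le hP).ne'
      (ne_top_of_le_ne_top hQ hPQ)
    exact sub_nonneg.2 (one_div_le_one_div_of_le h1 (ENNReal.toReal_mono hQ hPQ))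
  refine tendsto_of_tendsto_of_tendsto_of_le_of_le tendsto_const_nhds ?_ (fun _ => zero_le)
    fun i => eLpNorm_le_eLpNorm_mul_rpow_measure_univ hPQ (hf i)
  simpa using ENNReal.Tendsto.mul_const h
    (Or.inr (ENNReal.rpow_ne_top_of_nonneg hexp (measure_ne_top μ univ)))

/-! ### `L^Q` limits of test functions, and their relation to `V₀` -/

section TestLimit

variable {n : ℕ} {Ω : Set (EuclideanSpace ℝ (Fin n))} {Q : ℝ≥0∞}

/-- The pair `(u, g)` is the limit of test functions and their gradients in `L^Q(Ω)`. -/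
def IsTestLimit (Ω : Set (EuclideanSpace ℝ (Fin n))) (Q : ℝ≥0∞)
    (u : EuclideanSpace ℝ (Fin n) → ℝ) (g : EuclideanSpace ℝ (Fin n) → EuclideanSpace ℝ (Fin n)) :
    Prop :=
  AEStronglyMeasurable u (volume.restrict Ω) ∧ AEStronglyMeasurable g (volume.restrict Ω) ∧
    ∀ ε : ℝ≥0∞, ε ≠ 0 → ∃ φ, IsTestFunction Ω φ ∧ eLpNorm (u - φ) Q (volume.restrict Ω) ≤ ε ∧
      eLpNorm (g - gradient φ) Q (volume.restrict Ω) ≤ ε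

theorem IsTestFunction.isTestLimit {φ : EuclideanSpace ℝ (Fin n) → ℝ} (hφ : IsTestFunction Ω φ)
    {u : EuclideanSpace ℝ (Fin n) → ℝ} {g : EuclideanSpace ℝ (Fin n) → EuclideanSpace ℝ (Fin n)}
    (hu : u =ᵐ[volume.restrict Ω] φ) (hg : g =ᵐ[volume.restrict Ω] gradient φ) :
    IsTestLimit Ω Q u g := by
  refine ⟨hφ.1.continuous.aestronglyMeasurable.congr hu.symm,
    hφ.continuous_gradient.aestronglyMeasurable.congr hg.symm, fun ε _ => ⟨φ, hφ, ?_, ?_⟩⟩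
  · rw [eLpNorm_congr_ae (hu.sub EventuallyEq.rfl), sub_self, eLpNorm_zero]
    exact zero_le
  · rw [eLpNorm_congr_ae (hg.sub EventuallyEq.rfl), sub_self, eLpNorm_zero]
    exact zero_le

namespace IsTestLimit

variable {u u' : EuclideanSpace ℝ (Fin n) → ℝ}
  {g g' : EuclideanSpace ℝ (Fin n) → EuclideanSpace ℝ (Fin n)}

/-- Makes the sup bound available for `v_j - v_k` without having to know that `V₀` is a linear
space. -/
theorem sub (hQ : 1 ≤ Q) (h : IsTestLimit Ω Q u g) (h' : IsTestLimit Ω Q u' g') :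
    IsTestLimit Ω Q (u - u') (g - g') := by
  refine ⟨h.1.sub h'.1, h.2.1.sub h'.2.1, fun ε hε => ?_⟩
  have hε2 : ε / 2 ≠ 0 := (ENNReal.half_pos hε).ne'
  obtain ⟨φ, hφ, h1, h2⟩ := h.2.2 _ hε2
  obtain ⟨φ', hφ', h1', h2'⟩ := h'.2.2 _ hε2
  refine ⟨φ - φ', hφ.sub hφ', ?_, ?_⟩
  · rw [sub_sub_sub_comm, ← ENNReal.add_halves ε]
    exact (eLpNorm_sub_le (h.1.sub hφ.1.continuous.aestronglyMeasurable)
      (h'.1.sub hφ'.1.continuous.aestronglyMeasurable) hQ).trans (add_le_add h1 h1')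
  · rw [hφ.gradient_sub hφ', sub_sub_sub_comm, ← ENNReal.add_halves ε]
    exact (eLpNorm_sub_le (h.2.1.sub hφ.continuous_gradient.aestronglyMeasurable)
      (h'.2.1.sub hφ'.continuous_gradient.aestronglyMeasurable) hQ).trans (add_le_add h2 h2')

theorem of_approx (hQ : 1 ≤ Q) (hu : AEStronglyMeasurable u (volume.restrict Ω))
    (hg : AEStronglyMeasurable g (volume.restrict Ω))
    (h : ∀ ε : ℝ≥0∞, ε ≠ 0 → ∃ u' g', IsTestLimit Ω Q u' g' ∧
      eLpNorm (u - u') Q (volume.restrict Ω) ≤ ε ∧ eLpNorm (g - g') Q (volume.restrict Ω) ≤ ε) :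
    IsTestLimit Ω Q u g := by
  refine ⟨hu, hg, fun ε hε => ?_⟩
  have hε2 : ε / 2 ≠ 0 := (ENNReal.half_pos hε).ne'
  obtain ⟨u', g', h', h1, h2⟩ := h _ hε2
  obtain ⟨φ, hφ, h3, h4⟩ := h'.2.2 _ hε2
  refine ⟨φ, hφ, ?_, ?_⟩
  · rw [← sub_add_sub_cancel u u' φ, ← ENNReal.add_halves ε]
    exact (eLpNorm_add_le (hu.sub h'.1) (h'.1.sub hφ.1.continuous.aestronglyMeasurable)
      hQ).trans (add_le_add h1 h3)
  · rw [← sub_add_sub_cancel g g' (gradient φ), ← ENNReal.add_halves ε]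
    exact (eLpNorm_add_le (hg.sub h'.2.1) (h'.2.1.sub
      hφ.continuous_gradient.aestronglyMeasurable) hQ).trans (add_le_add h2 h4)

theorem memLp_gradient (h : IsTestLimit Ω Q u g) : MemLp g Q (volume.restrict Ω) := by
  obtain ⟨φ, hφ, -, h2⟩ := h.2.2 1 one_ne_zero
  have h3 : MemLp (g - gradient φ) Q (volume.restrict Ω) :=
    ⟨h.2.1.sub hφ.continuous_gradient.aestronglyMeasurable, h2.trans_lt ENNReal.one_lt_top⟩
  have h4 : MemLp (gradient φ) Q (volume.restrict Ω) :=
    (hφ.continuous_gradient.memLp_of_hasCompactSupport hφ.hasCompactSupport_gradient).restrict Ω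
  simpa using h3.add h4

/-- Apply the sup bound to approximating test functions and let a subsequence converge almost
everywhere. -/
theorem eLpNorm_top_le (hQ : 1 ≤ Q) (h : IsTestLimit Ω Q u g) {C : ℝ≥0∞} (hC : C ≠ ⊤)
    (hCφ : ∀ φ, IsTestFunction Ω φ →
      ∀ x, ‖φ x‖ₑ ≤ C * eLpNorm (gradient φ) Q (volume.restrict Ω)) :
    eLpNorm u ⊤ (volume.restrict Ω) ≤ C * eLpNorm g Q (volume.restrict Ω) := by
  have hε : ∀ k : ℕ, ((k : ℝ≥0∞) + 1)⁻¹ ≠ 0 := fun k => by simp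
  have hε0 : Tendsto (fun k : ℕ => ((k : ℝ≥0∞) + 1)⁻¹) atTop (𝓝 0) := by
    have := (tendsto_add_atTop_iff_nat 1).2 ENNReal.tendsto_inv_nat_nhds_zero
    simpa using this
  choose φ hφ h1 h2 using fun k => h.2.2 _ (hε k)
  have h3 : Tendsto (fun k => eLpNorm (φ k - u) Q (volume.restrict Ω)) atTop (𝓝 0) := by
    refine tendsto_of_tendsto_of_tendsto_of_le_of_le tendsto_const_nhds hε0
      (fun _ => zero_le) fun k => ?_
    rw [eLpNorm_sub_comm]
    exact h1 k
  obtain ⟨s, hs, hsa⟩ := (tendstoInMeasure_of_tendsto_eLpNorm (zero_lt_one.trans_le hQ).ne'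
    (fun k => (hφ k).1.continuous.aestronglyMeasurable) h.1 h3).exists_seq_tendsto_ae
  rw [eLpNorm_exponent_top]
  refine eLpNormEssSup_le_of_ae_enorm_bound (hsa.mono fun x hx => ?_)
  have h4 : Tendsto (fun k => C * (eLpNorm g Q (volume.restrict Ω) + ((s k : ℝ≥0∞) + 1)⁻¹)) atTop
      (𝓝 (C * (eLpNorm g Q (volume.restrict Ω) + 0))) :=
    ENNReal.Tendsto.const_mul (tendsto_const_nhds.add (hε0.comp hs.tendsto_atTop)) (Or.inr hC)
  rw [add_zero] at h4
  refine le_of_tendsto_of_tendsto' hx.enorm h4 fun k => (hCφ _ (hφ _) x).trans ?_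
  gcongr
  have h5 : gradient (φ (s k)) = g - (g - gradient (φ (s k))) := by simp
  rw [h5]
  exact (eLpNorm_sub_le h.2.1 (h.2.1.sub (hφ _).continuous_gradient.aestronglyMeasurable)
    hQ).trans (add_le_add le_rfl (h2 _))

end IsTestLimit

variable {p : EuclideanSpace ℝ (Fin n) → ℝ} {q : ℝ}

theorem sobolevModular_sub_eq (hΩ : IsOpen Ω) {u u' : MeasurableClass Ω}
    {f f' : EuclideanSpace ℝ (Fin n) → ℝ}
    {g g' : EuclideanSpace ℝ (Fin n) → EuclideanSpace ℝ (Fin n)}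
    (hu : u =ᵐ[volume.restrict Ω] f) (hu' : u' =ᵐ[volume.restrict Ω] f')
    (h : HasWeakGradient Ω f g) (h' : HasWeakGradient Ω f' g') :
    sobolevModular Ω p (u - u') =
      lpModular Ω p (f - f') + lpModular Ω p fun x => ‖(g - g') x‖ :=
  sobolevModular_eq hΩ ((AEEqFun.coeFn_sub u u').trans (hu.sub hu')) (h.sub h')

/-- `V₀` is an intersection of closed sets, and its elements need not be presented as modular limits
of test functions. Minimality replaces sequences: the test limits form one of the closed sets being
intersected. -/
theorem isTestLimit_of_mem_V0Space (hΩ : IsOpen Ω) (hΩt : volume Ω ≠ ⊤)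
    (hp : ContinuousOn p Ω) (hq : 1 ≤ q) (hqp : ∀ x ∈ Ω, q ≤ p x) {u : sobolevSpace Ω p}
    (hu : u ∈ V0Space Ω p) :
    IsTestLimit Ω (ENNReal.ofReal q) (u : MeasurableClass Ω)
      (weakGradient Ω (u : MeasurableClass Ω)) := by
  have hQ : 1 ≤ ENNReal.ofReal q := ENNReal.one_le_ofReal.2 hq
  refine hu {u | IsTestLimit Ω (ENNReal.ofReal q) (u : MeasurableClass Ω)
    (weakGradient Ω (u : MeasurableClass Ω))} ⟨?_, ?_⟩
  · intro x y hx hxy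
    have hy := hasWeakGradient_of_mem_sobolevSpace y.2
    have h1 := fun j => sobolevModular_sub_eq (p := p) hΩ EventuallyEq.rfl EventuallyEq.rfl
      (hasWeakGradient_of_mem_sobolevSpace (x j).2) hy
    simp only [ModularTendsto, h1] at hxy
    have h2 := tendsto_eLpNorm_of_tendsto_lpModular hΩ hΩt hp hq hqp
      (tendsto_of_tendsto_of_tendsto_of_le_of_le tendsto_const_nhds hxy
        (fun _ => zero_le) fun _ => le_add_self)
    have h3 := tendsto_eLpNorm_of_tendsto_lpModular (w := fun j =>
        ⇑(x j : MeasurableClass Ω) - ⇑(y : MeasurableClass Ω))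
      hΩ hΩt hp hq hqp
      (tendsto_of_tendsto_of_tendsto_of_le_of_le tendsto_const_nhds hxy
        (fun _ => zero_le) fun j => (lpModular_abs _).le.trans le_self_add)
    refine IsTestLimit.of_approx hQ (AEEqFun.aestronglyMeasurable _)
      hy.2.1.aestronglyMeasurable fun ε hε => ?_
    obtain ⟨j, hj2, hj3⟩ := ((h2.eventually_le_const (pos_iff_ne_zero.2 hε)).and
      (h3.eventually_le_const (pos_iff_ne_zero.2 hε))).exists
    exact ⟨_, _, hx j, (eLpNorm_sub_comm _ _ _ _).trans_le hj3,
      (eLpNorm_sub_comm _ _ _ _).trans_le hj2⟩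
  · rintro v ⟨φ, hφ, hvφ⟩
    exact hφ.isTestLimit hvφ
      ((hasWeakGradient_of_mem_sobolevSpace v.2).ae_eq hΩ hφ.hasWeakGradient hvφ)

theorem exists_enorm_le_mul_eLpNorm_gradient (hn : 0 < n) (hq : (n : ℝ) < q)
    (hΩ : Bornology.IsBounded Ω) :
    ∃ C : ℝ≥0∞, C ≠ ⊤ ∧ ∀ φ, IsTestFunction Ω φ →
      ∀ x, ‖φ x‖ₑ ≤ C * eLpNorm (gradient φ) (ENNReal.ofReal q) (volume.restrict Ω) := by
  have : NeZero n := ⟨hn.ne'⟩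
  have : Nontrivial (EuclideanSpace ℝ (Fin n)) :=
    Module.nontrivial_of_finrank_pos (R := ℝ) (by simpa using hn)
  obtain ⟨C, hC, h⟩ := exists_enorm_le_mul_eLpNorm_fderiv
    (volume : Measure (EuclideanSpace ℝ (Fin n))) (q := q) (by simpa using hq) hΩ
  refine ⟨C, hC, fun φ hφ x => (h φ (hφ.1.of_le (by simp)) hφ.2.1 hφ.2.2 x).trans_eq ?_⟩
  rw [eLpNorm_congr_norm_ae (Eventually.of_forall fun x => norm_gradient_eq φ x)]

/-- The factor `1/2` turns a sum into a mean, hence into a maximum; a maximum passes through `t ↦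
t^p / p` with no doubling constant. -/
theorem norm_smul_le_max {F : Type*} [NormedAddCommGroup F] [NormedSpace ℝ F] {c : ℝ}
    (hc : 0 < c) (a b : F) : ‖(min c 1 / 2) • b‖ ≤ max ‖c • a‖ ‖a - b‖ := by
  have h0 : 0 < min c 1 := lt_min hc one_pos
  have h1 : ‖b‖ ≤ ‖a‖ + ‖a - b‖ := by
    simpa using norm_sub_le a (a - b)
  rw [norm_smul, norm_smul, Real.norm_of_nonneg (by positivity), Real.norm_of_nonneg hc.le]
  have h2 : min c 1 * ‖a‖ ≤ c * ‖a‖ := by gcongr; exact min_le_left _ _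
  have h3 : min c 1 * ‖a - b‖ ≤ 1 * ‖a - b‖ := by gcongr; exact min_le_right _ _
  have h4 : min c 1 * ‖b‖ ≤ min c 1 * (‖a‖ + ‖a - b‖) := by gcongr
  have h5 := le_max_left (c * ‖a‖) ‖a - b‖
  have h6 := le_max_right (c * ‖a‖) ‖a - b‖
  linarith

theorem mem_sobolevSpace_of_sobolevModular_sub_lt_top (hΩ : IsOpen Ω) (hp : ContinuousOn p Ω)
    (hp0 : ∀ x ∈ Ω, 0 < p x) {u w : MeasurableClass Ω} (hu : u ∈ sobolevSpace Ω p)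
    {g : EuclideanSpace ℝ (Fin n) → EuclideanSpace ℝ (Fin n)} (hw : HasWeakGradient Ω w g)
    (h : sobolevModular Ω p (u - w) < ⊤) : w ∈ sobolevSpace Ω p := by
  have hug := hasWeakGradient_of_mem_sobolevSpace hu
  obtain ⟨c, hc, hcu⟩ := hu
  rw [sobolevModular_eq hΩ (AEEqFun.coeFn_smul c u) (hug.const_smul c)] at hcu
  rw [sobolevModular_sub_eq hΩ EventuallyEq.rfl EventuallyEq.rfl hug hw] at h
  refine ⟨min c 1 / 2, by positivity, ?_⟩
  rw [sobolevModular_eq hΩ (AEEqFun.coeFn_smul _ w) (hw.const_smul _)]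
  have hum := (hug.1.smul c).aestronglyMeasurable.aemeasurable
  have hgm := (hug.2.1.smul c).aestronglyMeasurable.norm.aemeasurable
  refine (add_le_add
    (lpModular_le_add_of_le (v := u - w) hΩ.measurableSet hp hp0 hum
      (Eventually.of_forall fun x => norm_smul_le_max hc (u x) (w x)))
    (lpModular_le_add_of_le (v := fun x => ‖(weakGradient Ω u - g) x‖) hΩ.measurableSet hp hp0 hgm
      (Eventually.of_forall fun x => ?_))).trans_lt ?_
  · simpa only [abs_norm, Pi.sub_apply, Pi.smul_apply] using
      norm_smul_le_max hc (weakGradient Ω u x) (g x)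
  · rw [ENNReal.add_lt_top] at hcu h
    exact ENNReal.add_lt_top.2 ⟨ENNReal.add_lt_top.2 ⟨hcu.1, h.1⟩,
      ENNReal.add_lt_top.2 ⟨hcu.2, h.2⟩⟩

theorem exponentInf_le (h : 0 < exponentInf Ω p) {x : EuclideanSpace ℝ (Fin n)} (hx : x ∈ Ω) :
    exponentInf Ω p ≤ p x := by
  refine csInf_le ?_ (mem_image_of_mem p hx)
  -- A set unbounded below has `sInf` equal to `0`, which positivity excludes.
  by_contra hb
  exact h.ne' (Real.sInf_of_not_bddBelow hb)

theorem tendsto_lpModular_of_tendsto_eLpNorm_top (hΩ : MeasurableSet Ω) (hΩt : volume Ω ≠ ⊤)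
    (hp : ∀ x ∈ Ω, 1 ≤ p x) {u : ℕ → EuclideanSpace ℝ (Fin n) → ℝ}
    (hu : Tendsto (fun j => eLpNorm (u j) ⊤ (volume.restrict Ω)) atTop (𝓝 0)) :
    Tendsto (fun j => lpModular Ω p (u j)) atTop (𝓝 0) := by
  have h1 : Tendsto (fun j => eLpNorm (u j) ⊤ (volume.restrict Ω) * volume Ω) atTop (𝓝 0) := by
    simpa using ENNReal.Tendsto.mul_const hu (Or.inr hΩt)
  refine tendsto_of_tendsto_of_tendsto_of_le_of_le' tendsto_const_nhds h1
    (Eventually.of_forall fun _ => zero_le) ?_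
  filter_upwards [hu.eventually_le_const zero_lt_one] with j hj
  exact lpModular_le_of_eLpNorm_top_le hΩ hp hj le_rfl

/-- The limit in `L^Q` of a modular Cauchy sequence is its modular limit. -/
theorem tendsto_lpModular_sub_of_cauchy (hΩ : MeasurableSet Ω) (hp : ContinuousOn p Ω)
    (hp0 : ∀ x ∈ Ω, 0 < p x) (hQ : Q ≠ 0) {F : Type*} [NormedAddCommGroup F]
    {G : ℕ → EuclideanSpace ℝ (Fin n) → F} {g : EuclideanSpace ℝ (Fin n) → F}
    (hG : ∀ j, AEStronglyMeasurable (G j) (volume.restrict Ω))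
    (hg : AEStronglyMeasurable g (volume.restrict Ω))
    (hGg : Tendsto (fun j => eLpNorm (G j - g) Q (volume.restrict Ω)) atTop (𝓝 0))
    (hc : Tendsto (fun jk : ℕ × ℕ => lpModular Ω p fun x => ‖G jk.1 x - G jk.2 x‖) atTop (𝓝 0)) :
    Tendsto (fun j => lpModular Ω p fun x => ‖(G j - g) x‖) atTop (𝓝 0) := by
  obtain ⟨s, hs, hsa⟩ :=
    (tendstoInMeasure_of_tendsto_eLpNorm hQ hG hg hGg).exists_seq_tendsto_ae
  refine ENNReal.tendsto_nhds_zero.2 fun ε hε => ?_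
  obtain ⟨N, hN⟩ := eventually_atTop_prod_self'.1 (hc.eventually_le_const hε)
  filter_upwards [eventually_ge_atTop N] with j hj
  -- Fix `j ≥ N` and let only the second index tend to infinity along the subsequence: Fatou's lemma
  -- keeps the Cauchy bound `ε`.
  refine lpModular_le_of_tendsto_ae (u := fun k x => ‖G j x - G (s k) x‖) hΩ hp hp0
    (fun k => ((hG j).sub (hG (s k))).norm.aemeasurable)
    (hsa.mono fun x hx => (tendsto_const_nhds.sub hx).norm) ?_
  filter_upwards [hs.tendsto_atTop.eventually_ge_atTop N] with k hk
  exact hN j hj _ hk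

end TestLimit

/-! ### The main theorem -/

theorem lemma6p2 {n : ℕ} (hn : 0 < n) (Ω : Set (EuclideanSpace ℝ (Fin n)))
    (hΩ : IsBoundedC2Domain Ω) (p : EuclideanSpace ℝ (Fin n) → ℝ) (hp : ContinuousOn p Ω)
    (hpn : (n : ℝ) < exponentInf Ω p)
    (v : ℕ → sobolevSpace Ω p) (hv : ∀ j, v j ∈ V0Space Ω p)
    (hcauchy : Tendsto
      (fun jk : ℕ × ℕ => lpModular Ω p
        (fun x => ‖weakGradient Ω (v jk.1 : MeasurableClass Ω) x
          - weakGradient Ω (v jk.2 : MeasurableClass Ω) x‖))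
      atTop (𝓝 0)) :
    ∃ w ∈ V0Space Ω p,
      ModularTendsto (fun u : MeasurableClass Ω => lpModular Ω p u)
        (fun j => (v j : MeasurableClass Ω)) w ∧
      ModularTendsto (sobolevModular Ω p) (fun j => (v j : MeasurableClass Ω)) w ∧
      Tendsto v atTop (@nhds _ (modularTopology (sobolevModular Ω p)) w) := by
  set q := exponentInf Ω p with hqdef
  have hn1 : (1 : ℝ) ≤ n := by exact_mod_cast hn
  have hq1 : 1 ≤ q := hn1.trans hpn.le
  have hQ : 1 ≤ ENNReal.ofReal q := ENNReal.one_le_ofReal.2 hq1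
  have hqp : ∀ x ∈ Ω, q ≤ p x := fun x hx => exponentInf_le (by linarith) hx
  have hp1 : ∀ x ∈ Ω, 1 ≤ p x := fun x hx => hq1.trans (hqp x hx)
  have hp0 : ∀ x ∈ Ω, 0 < p x := fun x hx => zero_lt_one.trans_le (hp1 x hx)
  have hΩo := hΩ.isOpen
  have hΩm := hΩo.measurableSet
  have hΩt : volume Ω ≠ ⊤ := hΩ.isBounded.measure_lt_top.ne
  have : IsFiniteMeasure (volume.restrict Ω) := ⟨by simpa using hΩt.lt_top⟩
  have hW := fun j => hasWeakGradient_of_mem_sobolevSpace (v j).2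
  have hL := fun j => isTestLimit_of_mem_V0Space hΩo hΩt hp hq1 hqp (hv j)
  obtain ⟨C, hC, hCφ⟩ := exists_enorm_le_mul_eLpNorm_gradient hn hpn hΩ.isBounded
  have hgc : Tendsto (fun jk : ℕ × ℕ => eLpNorm (weakGradient Ω (v jk.1 : MeasurableClass Ω)
      - weakGradient Ω (v jk.2 : MeasurableClass Ω)) (ENNReal.ofReal q) (volume.restrict Ω))
      atTop (𝓝 0) :=
    tendsto_eLpNorm_of_tendsto_lpModular hΩo hΩt hp hq1 hqp hcauchy
  have hvc : Tendsto (fun jk : ℕ × ℕ => eLpNorm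
      (⇑(v jk.1 : MeasurableClass Ω) - ⇑(v jk.2 : MeasurableClass Ω)) ⊤ (volume.restrict Ω)) atTop (𝓝 0) := by
    -- The sup bound for the differences `v_j - v_k` converts gradient control in `L^q` into uniform
    -- control.
    refine tendsto_of_tendsto_of_tendsto_of_le_of_le tendsto_const_nhds
      (by simpa using ENNReal.Tendsto.const_mul hgc (Or.inr hC)) (fun _ => zero_le)
      fun jk => ((hL jk.1).sub hQ (hL jk.2)).eLpNorm_top_le hQ hC hCφ
  have hgm := fun j => (hL j).memLp_gradient
  have hvm : ∀ j, MemLp (v j : MeasurableClass Ω) ⊤ (volume.restrict Ω) := fun j =>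
    ⟨(hL j).1, ((hL j).eLpNorm_top_le hQ hC hCφ).trans_lt
      (ENNReal.mul_lt_top hC.lt_top (hgm j).2)⟩
  obtain ⟨g, hg, hgt⟩ := exists_memLp_tendsto_eLpNorm_of_cauchy hQ hgm hgc
  obtain ⟨f, hf, hft⟩ := exists_memLp_tendsto_eLpNorm_of_cauchy le_top hvm hvc
  set w : MeasurableClass Ω := AEEqFun.mk f hf.1 with hw
  have hwf : w =ᵐ[volume.restrict Ω] f := AEEqFun.coeFn_mk f hf.1
  have hfg : HasWeakGradient Ω f g := HasWeakGradient.of_tendsto hW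
    (hf.integrable le_top) (hg.integrable hQ)
    (tendsto_eLpNorm_of_exponent_le le_rfl le_top (fun j => (hL j).1.sub hf.1) hft)
    (tendsto_eLpNorm_of_exponent_le le_rfl hQ (fun j => (hL j).2.1.sub hg.1) hgt)
  have h1 := tendsto_lpModular_of_tendsto_eLpNorm_top hΩm hΩt hp1 hft
  have h2 := tendsto_lpModular_sub_of_cauchy hΩm hp hp0 (zero_lt_one.trans_le hQ).ne'
    (fun j => (hL j).2.1) hg.1 hgt hcauchy
  have hmod : ModularTendsto (sobolevModular Ω p) (fun j => (v j : MeasurableClass Ω)) w := by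
    have h3 := fun j => sobolevModular_sub_eq (p := p) hΩo EventuallyEq.rfl hwf (hW j) hfg
    simp only [ModularTendsto, h3]
    simpa using h1.add h2
  -- A single `v_j` at finite modular distance from `w` suffices to place `w` in `W^{1,p}`.
  obtain ⟨j, hj⟩ := (hmod.eventually_lt_const ENNReal.zero_lt_top).exists
  have hwS : w ∈ sobolevSpace Ω p := mem_sobolevSpace_of_sobolevModular_sub_lt_top hΩo hp hp0
    (v j).2 (hfg.congr_ae hwf.symm EventuallyEq.rfl) hj
  refine ⟨⟨w, hwS⟩, isModularClosed_modularClosure _ v ⟨w, hwS⟩ hv hmod, ?_, hmod,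
    ModularTendsto.tendsto_modularTopology (y := ⟨w, hwS⟩) hmod⟩
  refine h1.congr fun j => (lpModular_congr_ae ?_).symm
  exact (AEEqFun.coeFn_sub _ _).trans (EventuallyEq.rfl.sub hwf)
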